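/- Let $p$ be a prime, $s\ge 2$, and let $t_1\ge 1$, $t_2,\dots,t_{s-1}\ge 0$, $t_s\ge 1$ be integers. **Matrices.** Consider matrices $A=(A_1\mid\cdots\mid A_s)$ whose block $A_i$ has entries in $\mathbb Z_{p^i}$. Write $\mathbf a$ for a constant row vector with all entries $a$. Let $$A_p^{1,0,\dots,0,1}=\left(\begin{array}{ccc|ccc|c|ccc}1&\cdots&1&p&\cdots&p&\cdots&p^{s-1}&\cdots&p^{s-1}\\0&\cdots&p-1&1&\cdots&p-1&\cdots&1&\cdots&p-1\end{array}\right).$$ Given such a matrix $A$ with $r$ rows and $i\in\{1,\dots,s\}$, *step $i$* produces the matrix with $r+1$ rows $$\left(\begin{array}{ccc|c|c|c|c|c|c}A_1&\cdots&A_1&&&&&&\\ \mathbf 0&\cdots&\mathbf{p-1}&P_1&\cdots&P_{s-i}&Q_1&\cdots&Q_{i-1}\end{array}\right),$$ where $$P_j=\begin{pmatrix}M_j&\cdots&M_j&A_{j+1}&\cdots&A_{j+1}\\ \mathbf 1&\cdots&\mathbf{p-1}&\mathbf 0&\cdots&\mathbf{p^{j+1}-1}\end{pmatrix}\quad(1\le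 j\le s-i),$$ $$Q_k=\begin{pmatrix}A_{s-i+k+1}&\cdots&A_{s-i+k+1}\\ p^k\cdot\mathbf 0&\cdots&p^k\cdot(\mathbf{p^{s-i+1}-1})\end{pmatrix}\quad(1\le k\le i-1).$$ Here the blocks $P_j$ and $Q_k$ have entries in $\mathbb Z_{p^{j+1}}$ and $\mathbb Z_{p^{s-i+k+1}}$ respectively, and $M_j$ is the matrix over $\mathbb Z_{p^{j+1}}$ whose columns are all the vectors in $\{p^j\}\times\{p\cdot 0,p\cdot 1,\dots,p(p^j-1)\}^{r-1}$. The matrix $A_p^{t_1,\dots,t_s}$ is obtained from $A_p^{1,0,\dots,0,1}$ by applying step $1$ exactly $t_1-1$ times, then step $i$ exactly $t_i$ times for $i=2,\dots,s-1$ in this order, and finally step $s$ exactly $t_s-1$ times. It has $t_1+\cdots+t_s$ rows. Let $\alpha_i$ be the number of columns of its $i$th block, and let $\mathcal H=\mathcal H_p^{t_1,\dots,t_s}$ be the subgroup of $\mathbb Z_p^{\alpha_1}\times\mathbb Z_{p^2}^{\alpha_2}\times\cdots\times\mathbb Z_{p^s}^{\alpha_s}$ generated by its rows. **Gray map.** For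 $u=\sum_{i=0}^{r-1}u_ip^i\in\mathbb Z_{p^r}$ with digits $u_i\in\{0,\dots,p-1\}$, let $$\phi_r(u)=(u_{r-1},\dots,u_{r-1})+(u_0,\dots,u_{r-2})Y_{r-1}\in\mathbb Z_p^{p^{r-1}},$$ where the columns of the $(r-1)\times p^{r-1}$ matrix $Y_{r-1}$ are all the vectors of $\mathbb Z_p^{r-1}$, ordered as the $p$-ary expansions of $0,\dots,p^{r-1}-1$. Let $\Phi:\mathbb Z_p^{\alpha_1}\times\cdots\times\mathbb Z_{p^s}^{\alpha_s}\to\mathbb Z_p^{n}$, with $n=\alpha_1+p\alpha_2+\cdots+p^{s-1}\alpha_s$, apply $\phi_i$ to every coordinate over $\mathbb Z_{p^i}$, for $i=1,\dots,s$. **Statement.** Suppose that $\Phi(\mathcal H)$ is nonlinear, i.e. not a subspace of $\mathbb Z_p^n$. Let $w_k$ be the $k$th row of $A_p^{t_1,\dots,t_s}$ and $o(w_k)$ its additive order. Then the vectors $\Phi\big((o(w_k)/p)\,w_k\big)$, $k=1,\dots,t_1+\cdots+t_s$, form a basis of the kernel $K(\Phi(\mathcal H))=\{x\in\mathbb Z_p^n: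 x+\Phi(\mathcal H)=\Phi(\mathcal H)\}$. In particular this kernel has dimension $t_1+\cdots+t_s$ over $\mathbb Z_p$. -/

import Mathlib

namespace GHCode

/-- A matrix `A = (A_1 ∣ ⋯ ∣ A_s)` with `m + 1` rows, whose block `A_i` has entries in `ℤ/p^i`.
The blocks are indexed from zero: `cols b` is the list of columns of `A_{b+1}`. -/
structure BlockMatrix (p s : ℕ) where
  /-- the number of rows below the first one -/
  m : ℕ
  /-- the columns of each block -/
  cols : (b : Fin s) → List (Fin (m + 1) → ZMod (p ^ ((b : ℕ) + 1)))

namespace BlockMatrix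

variable {p s : ℕ}

/-- The number of rows. -/
abbrev rows (A : BlockMatrix p s) : ℕ := A.m + 1

/-- The number `α_{b+1}` of columns of the block `A_{b+1}`. -/
abbrev width (A : BlockMatrix p s) (b : Fin s) : ℕ := (A.cols b).length

end BlockMatrix

/-- The mixed-alphabet space `ℤ_p^{α_1} × ℤ_{p^2}^{α_2} × ⋯ × ℤ_{p^s}^{α_s}`
(with `α b` standing for `α_{b+1}`). -/
abbrev Mixed (p : ℕ) {s : ℕ} (α : Fin s → ℕ) : Type :=
  (b : Fin s) → Fin (α b) → ZMod (p ^ ((b : ℕ) + 1))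

/-- The `k`-th row of `A`. -/
def BlockMatrix.row {p s : ℕ} (A : BlockMatrix p s) (k : Fin A.rows) : Mixed p A.width :=
  fun b c => (A.cols b).get c k

/-- The additive code (subgroup) generated by the rows of `A`. -/
def BlockMatrix.code {p s : ℕ} (A : BlockMatrix p s) : AddSubgroup (Mixed p A.width) :=
  AddSubgroup.closure (Set.range A.row)

/-- All vectors of length `n` with entries from the list `L`, in lexicographic order. -/
def tuples {R : Type} (L : List R) : (n : ℕ) → List (Fin n → R)
  | 0 => [Fin.elim0]
  | n + 1 => L.flatMap fun a => (tuples L n).map fun v => (Fin.cons a v : Fin (n + 1) → R)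

/-- The matrix `A_p^{1,0,…,0,1}`: the columns of block `1` are `(1, a)` for `a = 0, …, p - 1`, and
those of block `b + 1 ≥ 2` are `(p^b, a)` for `a = 1, …, p - 1`. -/
def baseMatrix (p s : ℕ) : BlockMatrix p s where
  m := 1
  cols b :=
    ((List.range p).filter fun a => (b : ℕ) = 0 ∨ a ≠ 0).map fun a =>
      ![((p ^ (b : ℕ) : ℕ) : ZMod (p ^ ((b : ℕ) + 1))), (a : ZMod (p ^ ((b : ℕ) + 1)))]

/-- `(B ⋯ B)` with the row `(𝐥_1 ⋯ 𝐥_k)` appended at the bottom, where `L = [l_1, …, l_k]`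
and there is one copy of the list of columns `B` for each entry of `L`. -/
def stack {R : Type} {n : ℕ} (B : List (Fin n → R)) (L : List R) : List (Fin (n + 1) → R) :=
  L.flatMap fun a => B.map fun z => (Fin.snoc z a : Fin (n + 1) → R)

/-- The columns of `M_j`, with `m + 1` entries in `ℤ/p^{j+1}`: the first entry is `p^j` and the
others run over `{p·0, p·1, …, p·(p^j - 1)}`. -/
def mCols (p j m : ℕ) : List (Fin (m + 1) → ZMod (p ^ (j + 1))) :=
  (tuples ((List.range (p ^ j)).map fun x => ((p * x : ℕ) : ZMod (p ^ (j + 1)))) m).map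
    fun w => (Fin.cons ((p ^ j : ℕ) : ZMod (p ^ (j + 1))) w : Fin (m + 1) → ZMod (p ^ (j + 1)))

/-- One step of the recursive construction, which increases `t_i` by one, where `i = e + 1`.
* Block `1` becomes `A_1 ⋯ A_1` over `𝟎, …, 𝐩-𝟏`.
* Block `j + 1` with `1 ≤ j ≤ s - i` becomes `P_j`.
* Block `s - i + k + 1` with `1 ≤ k ≤ i - 1` becomes `Q_k`. -/
def addRow {p s : ℕ} (e : Fin s) (A : BlockMatrix p s) : BlockMatrix p s where
  m := A.m + 1
  cols b :=
    let i : ℕ := (e : ℕ) + 1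
    if (b : ℕ) = 0 then
      stack (A.cols b) ((List.range p).map fun a => (a : ZMod (p ^ ((b : ℕ) + 1))))
    else if (b : ℕ) ≤ s - i then
      stack (mCols p b A.m)
          (((List.range p).filter fun a => a ≠ 0).map fun a => (a : ZMod (p ^ ((b : ℕ) + 1)))) ++
        stack (A.cols b)
          ((List.range (p ^ ((b : ℕ) + 1))).map fun a => (a : ZMod (p ^ ((b : ℕ) + 1))))
    else
      stack (A.cols b)
        ((List.range (p ^ (s - i + 1))).map fun a =>
          ((p ^ ((b : ℕ) - (s - i)) * a : ℕ) : ZMod (p ^ ((b : ℕ) + 1))))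

/-- The matrix `A_p^{t_1,…,t_s}` (with `t e` standing for `t_{e+1}`): starting from
`A_p^{1,0,…,0,1}`, add `t_1 - 1` rows of order `p^s`, then `t_2` rows of order `p^{s-1}`, and so on,
then `t_{s-1}` rows of order `p^2`, and finally `t_s - 1` rows of order `p`.
Meant for `2 ≤ s`, `1 ≤ t_1` and `1 ≤ t_s`. -/
def genMatrix (p : ℕ) {s : ℕ} (t : Fin s → ℕ) : BlockMatrix p s :=
  (List.finRange s).foldl
    (fun A e => (addRow e)^[if (e : ℕ) = 0 ∨ (e : ℕ) + 1 = s then t e - 1 else t e] A)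
    (baseMatrix p s)

/-- The `l`-th digit of the `p`-ary expansion of `n`. -/
def digit (p l n : ℕ) : ZMod p := ((n / p ^ l % p : ℕ) : ZMod p)

/-- The Gray map `φ_{r+1} : ℤ/p^{r+1} → ℤ_p^{p^r}`,
`φ_{r+1}(u) = (u_r, …, u_r) + (u_0, …, u_{r-1}) Y_r`, where the column of `Y_r` with
index `y` is the `p`-ary expansion of `y`. -/
def gray (p r : ℕ) (u : ZMod (p ^ (r + 1))) (y : Fin (p ^ r)) : ZMod p :=
  digit p r u.val + ∑ l : Fin r, digit p l u.val * digit p l y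

/-- The set of the `n = α_1 + p α_2 + ⋯ + p^{s-1} α_s` coordinates of Gray images. -/
abbrev GrayIdx (p : ℕ) {s : ℕ} (α : Fin s → ℕ) : Type :=
  Σ b : Fin s, Fin (α b) × Fin (p ^ (b : ℕ))

/-- The Gray map `Φ : ℤ_p^{α_1} × ⋯ × ℤ_{p^s}^{α_s} → ℤ_p^n`. -/
def Gray {p s : ℕ} {α : Fin s → ℕ} (y : Mixed p α) : GrayIdx p α → ZMod p :=
  fun c => gray p c.1 (y c.1 c.2.1) c.2.2

/-- The code `H_p^{t_1,…,t_s} = Φ(𝓗_p^{t_1,…,t_s})`, the Gray image of the additive code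
`𝓗_p^{t_1,…,t_s}` generated by the rows of `A_p^{t_1,…,t_s}`. -/
def grayCode (p : ℕ) {s : ℕ} (t : Fin s → ℕ) :
    Set (GrayIdx p (genMatrix p t).width → ZMod p) :=
  Gray '' ((genMatrix p t).code : Set (Mixed p (genMatrix p t).width))

/-- A code over `ℤ_p` is linear if it is a subspace. -/
def IsLinearCode {p : ℕ} {ι : Type} (C : Set (ι → ZMod p)) : Prop :=
  ∃ V : Submodule (ZMod p) (ι → ZMod p), (V : Set (ι → ZMod p)) = C

/-- The kernel `K(C) = {x : x + C = C}` of a code over `ℤ_p`; it is always a subspace. -/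
def kernel {p : ℕ} {ι : Type} (C : Set (ι → ZMod p)) : Submodule (ZMod p) (ι → ZMod p) :=
  AddSubgroup.toZModSubmodule p
    { carrier := {x | (fun c => x + c) '' C = C}
      zero_mem' := by simp
      add_mem' := by
        intro x y hx hy
        simp only [Set.mem_ofPred_eq] at hx hy ⊢
        conv_rhs => rw [← hx, ← hy, Set.image_image]
        simp only [add_assoc]
      neg_mem' := by
        intro x hx
        simp only [Set.mem_ofPred_eq] at hx ⊢
        conv_lhs => rw [← hx, Set.image_image]
        simp }

theorem mem_kernel {p : ℕ} {ι : Type} {C : Set (ι → ZMod p)} {x : ι → ZMod p} :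
    x ∈ kernel C ↔ (fun c => x + c) '' C = C := Iff.rfl

end GHCode

/-! The Gray map is carry-free addition in disguise: `Φ(w) = Φ(u) + Φ(v)` holds exactly when,
coordinate by coordinate, each `p`-ary digit of `w` is the sum mod `p` of those of `u` and `v`.
Adding an element of order `p` alters only the top digit, so `Φ(x + y) = Φ(x) + Φ(y)` whenever `p x
= 0`. Hence `Φ` sends the multiples `(o(w_k)/p) w_k` into the kernel, and their images are
independent because suitable coordinates form a triangular system (`exists_coordinate`).

Conversely, let `Φ(x)` lie in the kernel, with `x = ∑ u_k w_k`. Every `Φ(x) + Φ(y)` is then again a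
codeword, and a carry shows that `o(w_k)/p` divides each `u_k`. For odd `p` take `y = x` and read
the columns with entry `1` or `p - 1` in row `k` and zeros in the other rows below the first
(`dvd_of_Gray_double`). For `p = 2` take `y` to be a multiple of another row, and read a column that
is nonzero in both rows (`two_pow_dvd`, `two_pow_dvd_one`). The binary argument for the row of index
`1` needs a further row of order at least `4`. If there is none, the code is linear
(`IsStandard.isLinearCode`), which is excluded.

Only a few columns matter; `IsStandard` records them and is preserved by the recursive construction.
-/

namespace GHCode

/-! ### Digits, carries and the Gray map on one coordinate -/

section Digits

theorem digit_eq_natCast (p l n : ℕ) : digit p l n = ((n / p ^ l : ℕ) : ZMod p) := by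
  simp [digit]

theorem digit_zero_right (p l : ℕ) : digit p l 0 = 0 := by
  simp [digit]

theorem digit_zero_left (p n : ℕ) : digit p 0 n = (n : ZMod p) := by
  simp [digit_eq_natCast]

theorem digit_mod {p r l : ℕ} (hl : l ≤ r) (n : ℕ) :
    digit p l (n % p ^ (r + 1)) = digit p l n := by
  obtain ⟨d, rfl⟩ := Nat.exists_eq_add_of_le hl
  have h : p ^ (l + d + 1) = p ^ l * (p * p ^ d) := by ring
  rw [digit, digit, h, Nat.mod_mul_right_div_self, Nat.mod_mul_right_mod]

theorem digit_pow_mul {p : ℕ} (hp : 0 < p) (e l n : ℕ) :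
    digit p (e + l) (p ^ e * n) = digit p l n := by
  rw [digit, digit, pow_add, Nat.mul_div_mul_left _ _ (pow_pos hp e)]

theorem digit_pow_mul_of_lt {p l e : ℕ} (h : l < e) (n : ℕ) : digit p l (p ^ e * n) = 0 := by
  have := digit_mod (p := p) (Nat.le_sub_one_of_lt h) (p ^ e * n)
  rw [Nat.sub_add_cancel (by omega), Nat.mul_mod_right, digit_zero_right] at this
  exact this.symm

/-- Adding a multiple of `p ^ r` changes no digit below the `r`-th, and the `r`-th one additively. -/
theorem digit_mul_pow_add {p r l : ℕ} (hp : 0 < p) (hl : l ≤ r) (x y : ℕ) :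
    digit p l (x * p ^ r + y) = (if l = r then (x : ZMod p) else 0) + digit p l y := by
  split_ifs with h
  · subst h
    rw [digit_eq_natCast, digit_eq_natCast, add_comm, Nat.add_mul_div_right _ _ (pow_pos hp l)]
    push_cast
    ring
  · obtain ⟨d, rfl⟩ : ∃ d, r = d + 1 := ⟨r - 1, by omega⟩
    rw [← digit_mod (show l ≤ d by omega), ← digit_mod (show l ≤ d by omega) y,
      Nat.mul_add_mod_self_right, zero_add]

theorem digit_pow {p : ℕ} (hp : 1 < p) (l k : ℕ) :
    digit p l (p ^ k) = if l = k then 1 else 0 := by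
  split_ifs with h
  · subst h
    simpa [digit_zero_left] using digit_pow_mul (p := p) (by omega) l 0 1
  · rcases lt_or_gt_of_ne h with h | h
    · simpa using digit_pow_mul_of_lt (p := p) h 1
    · rw [digit_eq_natCast, Nat.div_eq_of_lt (Nat.pow_lt_pow_right hp h), Nat.cast_zero]

theorem pow_dvd_of_digit_eq_zero {p n v : ℕ} (hp : 0 < p) (h : ∀ l < v, digit p l n = 0) :
    p ^ v ∣ n := by
  induction v with
  | zero => simp
  | succ v ih =>
    obtain ⟨q, rfl⟩ := ih fun l hl => h l (by omega)
    have hv := h v (by omega)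
    rw [show digit p v (p ^ v * q) = _ from digit_pow_mul hp v 0 q, digit_zero_left,
      ZMod.natCast_eq_zero_iff] at hv
    exact pow_succ p v ▸ Nat.mul_dvd_mul_left _ hv

/-- Write `x = q p + r` with `0 < r < p`. Then `x (p - 1) = (p - r) + p ((p - 1) q + r - 1)`. The
constant `-1` is a borrow, and it is what breaks additivity for odd `p`. -/
theorem digit_one_pred_mul {p x : ℕ} (hp : 0 < p) (hx : ¬p ∣ x) :
    digit p 1 (x * (p - 1)) = digit p 0 x - digit p 1 x - 1 := by
  have hr : 0 < x % p := Nat.pos_of_ne_zero fun h => hx (Nat.dvd_of_mod_eq_zero h)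
  have hlt : x % p < p := Nat.mod_lt _ hp
  obtain ⟨d, hd⟩ : ∃ d, p = d + 1 := ⟨p - 1, by omega⟩
  obtain ⟨r, hr'⟩ : ∃ r, x % p = r + 1 := ⟨x % p - 1, by omega⟩
  have hx' := Nat.div_add_mod x p
  have key : x * (p - 1) = (p - (r + 1)) + p * ((p - 1) * (x / p) + r) := by
    obtain ⟨c, hc⟩ : ∃ c, d = r + c := ⟨d - r, by omega⟩
    rw [hr'] at hx'
    generalize x / p = q at *
    subst hd hc hx'
    simp only [Nat.add_sub_cancel, show r + c + 1 - (r + 1) = c by omega]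
    ring
  have hdiv : x * (p - 1) / p = (p - 1) * (x / p) + r := by
    rw [key, Nat.add_mul_div_left _ _ hp, Nat.div_eq_of_lt (by omega), zero_add]
  have hx0 : (x : ZMod p) = (r : ZMod p) + 1 := by
    rw [← ZMod.natCast_mod, hr']; push_cast; ring
  have hd0 : ((p - 1 : ℕ) : ZMod p) = -1 := by
    rw [Nat.cast_sub hp]; simp
  rw [digit_zero_left, digit_eq_natCast, digit_eq_natCast, pow_one, hdiv, hx0]
  push_cast
  rw [hd0]
  ring

/-- Nothing is added below bit `v`, and there a `1` is added, so the carry into bit `v + 1` is bit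
`v` of `z`. -/
theorem digit_two_succ_add {l v : ℕ} (hl : ¬2 ∣ l) (z : ℕ) :
    digit 2 (v + 1) (2 ^ v * l + z) =
      digit 2 (v + 1) (2 ^ v * l) + digit 2 (v + 1) z + digit 2 v z := by
  have h2 : 0 < 2 ^ v := by positivity
  have hq : (((z / 2 ^ v) % 2 : ℕ) : ZMod 2) = ((z / 2 ^ v : ℕ) : ZMod 2) := ZMod.natCast_mod _ 2
  simp only [digit_eq_natCast, pow_succ, ← Nat.div_div_eq_div_mul]
  rw [Nat.mul_add_div h2, Nat.mul_div_cancel_left _ h2, ← hq, ← Nat.cast_add, ← Nat.cast_add]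
  congr 1
  omega

theorem digit_two_xor (l m n : ℕ) : digit 2 l (m ^^^ n) = digit 2 l m + digit 2 l n := by
  have h (a : ℕ) : digit 2 l a = if a.testBit l then 1 else 0 := by
    rw [digit, Nat.testBit_eq_decide_div_mod_eq]
    rcases Nat.mod_two_eq_zero_or_one (a / 2 ^ l) with h | h <;> simp [h]
  rw [h, h, h, Nat.testBit_xor]
  cases m.testBit l <;> cases n.testBit l <;> decide

variable {p : ℕ}

theorem gray_zero (p r : ℕ) (y : Fin (p ^ r)) : gray p r 0 y = 0 := by
  simp [gray, digit_zero_right]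

theorem digit_val_natCast {r l : ℕ} (hl : l ≤ r) (n : ℕ) :
    digit p l (n : ZMod (p ^ (r + 1))).val = digit p l n := by
  rw [ZMod.val_natCast, digit_mod hl]

theorem gray_natCast (r n : ℕ) (y : Fin (p ^ r)) :
    gray p r (n : ZMod (p ^ (r + 1))) y =
      digit p r n + ∑ l : Fin r, digit p l n * digit p l y := by
  simp only [gray]
  rw [digit_val_natCast le_rfl]
  congr 1
  exact Finset.sum_congr rfl fun l _ => by rw [digit_val_natCast l.2.le]

theorem gray_of_digit_add {r : ℕ} {u v w : ℕ}
    (h : ∀ l ≤ r, digit p l w = digit p l u + digit p l v) (y : Fin (p ^ r)) :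
    gray p r (w : ZMod (p ^ (r + 1))) y = gray p r (u : ZMod (p ^ (r + 1))) y + gray p r v y := by
  simp only [gray_natCast, h r le_rfl]
  rw [Finset.sum_congr rfl fun l _ => by rw [h l l.2.le, add_mul], Finset.sum_add_distrib]
  ring

variable [hp : Fact p.Prime]

theorem exists_eq_mul_pow {r : ℕ} {u : ZMod (p ^ (r + 1))} (hu : (p : ZMod (p ^ (r + 1))) * u = 0) :
    ∃ c : ℕ, u = ((c * p ^ r : ℕ) : ZMod (p ^ (r + 1))) := by
  have h : p ^ (r + 1) ∣ p * u.val := by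
    rw [← ZMod.natCast_eq_zero_iff]
    push_cast
    rwa [ZMod.natCast_zmod_val]
  obtain ⟨c, hc⟩ := h
  replace hc := Nat.eq_of_mul_eq_mul_left hp.out.pos
    (hc.trans (by ring : p ^ (r + 1) * c = p * (p ^ r * c)))
  exact ⟨c, by rw [mul_comm, ← hc, ZMod.natCast_zmod_val]⟩

theorem gray_natCast_mul_pow (r c : ℕ) (y : Fin (p ^ r)) :
    gray p r ((c * p ^ r : ℕ) : ZMod (p ^ (r + 1))) y = c := by
  have h (l : ℕ) (hl : l ≤ r) := digit_mul_pow_add hp.out.pos hl c 0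
  rw [gray_natCast, ← add_zero (c * p ^ r), h r le_rfl,
    Finset.sum_eq_zero fun l _ => by rw [h l l.2.le]; simp [l.2.ne, digit_zero_right]]
  simp [digit_zero_right]

/-- An element killed by `p` is `c p ^ r`; adding it changes the top digit by `c` and produces no
carry that survives modulo `p ^ (r + 1)`. -/
theorem gray_add_of_torsion {r : ℕ} {u : ZMod (p ^ (r + 1))}
    (hu : (p : ZMod (p ^ (r + 1))) * u = 0) (v : ZMod (p ^ (r + 1))) (y : Fin (p ^ r)) :
    gray p r (u + v) y = gray p r u y + gray p r v y := by
  obtain ⟨c, rfl⟩ := exists_eq_mul_pow hu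
  rw [← ZMod.natCast_zmod_val v, ← Nat.cast_add]
  refine gray_of_digit_add (fun l hl => ?_) y
  rw [digit_mul_pow_add hp.out.pos hl, ← add_zero (c * p ^ r), digit_mul_pow_add hp.out.pos hl]
  simp [digit_zero_right]

/-- The entry at `y = 0` is the top digit, and the entry at `y = p ^ l` is the top digit plus digit
`l`, so the Gray image determines all digits linearly. -/
theorem digit_add_of_gray {r : ℕ} {u v w : ZMod (p ^ (r + 1))}
    (h : ∀ y, gray p r w y = gray p r u y + gray p r v y) {l : ℕ} (hl : l ≤ r) :
    digit p l w.val = digit p l u.val + digit p l v.val := by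
  have htop (u : ZMod (p ^ (r + 1))) : gray p r u ⟨0, pow_pos hp.out.pos r⟩ = digit p r u.val := by
    simp [gray, digit_zero_right]
  have h0 := h ⟨0, pow_pos hp.out.pos r⟩
  simp only [htop] at h0
  rcases hl.eq_or_lt with rfl | hl
  · exact h0
  · have hlow (u : ZMod (p ^ (r + 1))) :
        gray p r u ⟨p ^ l, Nat.pow_lt_pow_right hp.out.one_lt hl⟩ =
          digit p r u.val + digit p l u.val := by
      simp only [gray, digit_pow hp.out.one_lt]
      rw [Finset.sum_eq_single (⟨l, hl⟩ : Fin r)]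
      · simp
      · intro i _ hi
        simp [show (i : ℕ) ≠ l from fun h => hi (Fin.ext h)]
      · simp
    have h1 := h ⟨p ^ l, Nat.pow_lt_pow_right hp.out.one_lt hl⟩
    simp only [hlow, h0] at h1
    linear_combination h1

end Digits

/-! ### The columns of the recursively built matrices -/

section Columns

theorem mem_stack {R : Type} {n : ℕ} {B : List (Fin n → R)} {L : List R} {c : Fin (n + 1) → R} :
    c ∈ stack B L ↔ ∃ z ∈ B, ∃ a ∈ L, (Fin.snoc z a : Fin (n + 1) → R) = c := by
  simp only [stack, List.mem_flatMap, List.mem_map]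
  exact ⟨fun ⟨a, ha, z, hz, h⟩ => ⟨z, hz, a, ha, h⟩, fun ⟨z, hz, a, ha, h⟩ => ⟨a, ha, z, hz, h⟩⟩

theorem restrict_mem_stack {R : Type} {n : ℕ} {B : List (Fin n → R)} {L : List R} {z : ℕ → R}
    (hz : (fun i : Fin n => z i) ∈ B) (hL : z n ∈ L) :
    (fun i : Fin (n + 1) => z i) ∈ stack B L := by
  refine mem_stack.2 ⟨_, hz, _, hL, ?_⟩
  ext i
  refine Fin.lastCases ?_ (fun i => ?_) i <;> simp

/-- The left side is the form in which `L.map fun a => (a : R)` elaborates: the whole list is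
coerced first, then mapped by the identity. -/
theorem mem_natCast_list {R : Type} [NatCast R] {L : List ℕ} {x : R} :
    x ∈ List.map (fun a => a) (do let a ← L; pure (a : R)) ↔ ∃ a ∈ L, (a : R) = x := by
  simp [eq_comm]

theorem mem_tuples {R : Type} {L : List R} :
    ∀ {n : ℕ} {v : Fin n → R}, v ∈ tuples L n ↔ ∀ i, v i ∈ L
  | 0, v => by simp [tuples, Subsingleton.elim v Fin.elim0]
  | n + 1, v => by
    simp only [tuples, List.mem_flatMap, List.mem_map, mem_tuples]
    constructor
    · rintro ⟨a, ha, w, hw, rfl⟩ i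
      refine Fin.cases ?_ (fun i => ?_) i
      · simpa using ha
      · simpa using hw i
    · exact fun h => ⟨v 0, h 0, Fin.tail v, fun i => h i.succ, Fin.cons_self_tail v⟩

theorem mem_mCols {p j m : ℕ} {c : Fin (m + 1) → ZMod (p ^ (j + 1))} :
    c ∈ mCols p j m ↔ c 0 = ((p ^ j : ℕ) : ZMod (p ^ (j + 1))) ∧
      ∀ i : Fin m, ∃ x < p ^ j, c i.succ = ((p * x : ℕ) : ZMod (p ^ (j + 1))) := by
  simp only [mCols, List.mem_map, mem_tuples, List.mem_range]
  constructor
  · rintro ⟨w, hw, rfl⟩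
    refine ⟨rfl, fun i => ?_⟩
    obtain ⟨x, hx, h⟩ := hw i
    exact ⟨x, hx, by simp [← h]⟩
  · rintro ⟨h0, h⟩
    refine ⟨Fin.tail c, fun i => ?_, ?_⟩
    · obtain ⟨x, hx, h⟩ := h i
      exact ⟨x, hx, h.symm⟩
    · rw [← h0]
      exact Fin.cons_self_tail c

variable {p s : ℕ}

/-- The block `b` of `A` has the column with entries `z 0, z 1, …`. -/
def BlockMatrix.HasCol (A : BlockMatrix p s) (b : Fin s) (z : ℕ → ℕ) : Prop :=
  (fun i : Fin (A.m + 1) => (z i : ZMod (p ^ ((b : ℕ) + 1)))) ∈ A.cols b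

/-- The new row has order `p ^ (s - e)`. The truncated exponent `b + 1 - (s - e)` covers all blocks
at once: it is zero in block `1` and in the blocks `P_j`, and it is the `k` of `Q_k` otherwise. -/
theorem hasCol_addRow {A : BlockMatrix p s} {e b : Fin s} {z : ℕ → ℕ}
    (h : A.HasCol b z) {x : ℕ} (hx : x < p) (hz : z (A.m + 1) = p ^ ((b : ℕ) + 1 - (s - e)) * x) :
    (addRow e A).HasCol b z := by
  have he := e.2
  unfold BlockMatrix.HasCol at h ⊢
  unfold addRow
  simp only
  split_ifs with h0 h1
  · refine restrict_mem_stack (R := ZMod (p ^ ((b : ℕ) + 1)))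
      (z := fun i => (z i : ZMod (p ^ ((b : ℕ) + 1)))) h
      (mem_natCast_list.2 ⟨x, List.mem_range.2 hx, ?_⟩)
    rw [hz, show (b : ℕ) + 1 - (s - e) = 0 by omega, pow_zero, one_mul]
  · refine List.mem_append_right _
      (restrict_mem_stack (R := ZMod (p ^ ((b : ℕ) + 1)))
      (z := fun i => (z i : ZMod (p ^ ((b : ℕ) + 1)))) h
        (mem_natCast_list.2 ⟨x, List.mem_range.2 ?_, ?_⟩))
    · exact hx.trans_le (Nat.le_self_pow (by omega) p)
    · rw [hz, show (b : ℕ) + 1 - (s - e) = 0 by omega, pow_zero, one_mul]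
  · refine restrict_mem_stack (R := ZMod (p ^ ((b : ℕ) + 1)))
      (z := fun i => (z i : ZMod (p ^ ((b : ℕ) + 1)))) h
      (List.mem_map.2 ⟨x, List.mem_range.2 ?_, ?_⟩)
    · exact hx.trans_le (Nat.le_self_pow (by omega) p)
    · rw [hz, show (b : ℕ) + 1 - (s - e) = (b : ℕ) - (s - (e + 1)) by omega]

theorem hasCol_addRow_of_lt {A : BlockMatrix p s} {e b : Fin s} {z : ℕ → ℕ}
    (hb : (b : ℕ) ≠ 0) (hbe : (b : ℕ) + 1 ≤ s - e) (h0 : z 0 = p ^ (b : ℕ))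
    (hz : ∀ i, 1 ≤ i → i ≤ A.m → z i = 0) (hpos : 0 < z (A.m + 1)) (hlt : z (A.m + 1) < p) :
    (addRow e A).HasCol b z := by
  unfold BlockMatrix.HasCol addRow
  simp only
  rw [if_neg hb, if_pos (by omega)]
  refine List.mem_append_left _ (restrict_mem_stack (R := ZMod (p ^ ((b : ℕ) + 1)))
      (z := fun i => (z i : ZMod (p ^ ((b : ℕ) + 1))))
    (mem_mCols.2 ⟨by simp [h0], fun i => ?_⟩) (mem_natCast_list.2
      ⟨_, List.mem_filter.2 ⟨List.mem_range.2 hlt, by simpa using hpos.ne'⟩, rfl⟩))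
  refine ⟨0, pow_pos (by omega) _, ?_⟩
  rw [hz _ (by simp) (by simp), mul_zero]

theorem mem_cols_addRow {A : BlockMatrix p s} {e b : Fin s}
    {c : Fin (A.m + 1 + 1) → ZMod (p ^ ((b : ℕ) + 1))} (hc : c ∈ (addRow e A).cols b) :
    (∃ z ∈ A.cols b, ∃ x : ℕ, c = (Fin.snoc z ((p ^ ((b : ℕ) + 1 - (s - e)) * x : ℕ) :
        ZMod (p ^ ((b : ℕ) + 1))) : Fin (A.m + 1 + 1) → ZMod (p ^ ((b : ℕ) + 1)))) ∨
      ((b : ℕ) ≠ 0 ∧ (b : ℕ) + 1 ≤ s - e ∧ ∃ z ∈ mCols p b A.m, ∃ x : ℕ,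
        c = (Fin.snoc z (x : ZMod (p ^ ((b : ℕ) + 1))) :
          Fin (A.m + 1 + 1) → ZMod (p ^ ((b : ℕ) + 1)))) := by
  have he := e.2
  unfold addRow at hc
  simp only at hc
  split_ifs at hc with h0 h1
  · obtain ⟨z, hz, a, ha, rfl⟩ := mem_stack.1 hc
    obtain ⟨x, -, rfl⟩ := mem_natCast_list.1 ha
    refine Or.inl ⟨z, hz, x, ?_⟩
    rw [show (b : ℕ) + 1 - (s - e) = 0 by omega, pow_zero, one_mul]
  · rcases List.mem_append.1 hc with hc | hc
    · obtain ⟨z, hz, a, ha, rfl⟩ := mem_stack.1 hc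
      obtain ⟨x, -, rfl⟩ := mem_natCast_list.1 ha
      exact Or.inr ⟨h0, by omega, z, hz, x, rfl⟩
    · obtain ⟨z, hz, a, ha, rfl⟩ := mem_stack.1 hc
      obtain ⟨x, -, rfl⟩ := mem_natCast_list.1 ha
      refine Or.inl ⟨z, hz, x, ?_⟩
      rw [show (b : ℕ) + 1 - (s - e) = 0 by omega, pow_zero, one_mul]
  · obtain ⟨z, hz, a, ha, rfl⟩ := mem_stack.1 hc
    obtain ⟨x, -, rfl⟩ := List.mem_map.1 ha
    refine Or.inl ⟨z, hz, x, ?_⟩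
    rw [show (b : ℕ) + 1 - (s - e) = (b : ℕ) - (s - (e + 1)) by omega]

/-- The properties of the columns of `A_p^{t_1,…,t_s}` that determine the kernel of its code,
where `p ^ σ k` is the order of the row `k`. -/
structure IsStandard (A : BlockMatrix p s) (σ : ℕ → ℕ) : Prop where
  one_le_m : 1 ≤ A.m
  exp_zero : σ 0 = 1
  exp_one : σ 1 = s
  one_le_exp : ∀ k, 1 ≤ σ k
  exp_le : ∀ k, σ k ≤ s
  torsion : ∀ b, ∀ c ∈ A.cols b, ∀ k : Fin (A.m + 1),
    ((p ^ σ k : ℕ) : ZMod (p ^ ((b : ℕ) + 1))) * c k = 0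
  zero_col : ∀ b : Fin s, (b : ℕ) = 0 → A.HasCol b (Pi.single 0 (p ^ (b : ℕ)))
  unit_col : ∀ (b : Fin s) (k a : ℕ), 1 ≤ k → k ≤ A.m → (b : ℕ) < σ k → 0 < a → a < p →
    A.HasCol b (Pi.single 0 (p ^ (b : ℕ)) + Pi.single k a)
  -- The entry in row `j` is the smallest power of `p` that `p ^ σ j` kills modulo `p ^ (b + 1)`;
  -- truncated subtraction makes it `1` when `b < σ j`.
  pair_col : ∀ (b : Fin s) (j : ℕ), 2 ≤ j → j ≤ A.m →
    A.HasCol b (Pi.single 0 (p ^ (b : ℕ)) + Pi.single 1 1 + Pi.single j (p ^ ((b : ℕ) + 1 - σ j)))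
  zero_or_one : p = 2 → (∀ j, 2 ≤ j → j ≤ A.m → σ j = 1) → ∀ b, ∀ c ∈ A.cols b,
    ∀ k : Fin (A.m + 1), (k : ℕ) = 1 → c k = 0 ∨ c k = 1

theorem natCast_pow_eq_zero {r n : ℕ} (h : r ≤ n) : ((p ^ n : ℕ) : ZMod (p ^ r)) = 0 :=
  (ZMod.natCast_eq_zero_iff _ _).2 (pow_dvd_pow p h)

theorem mem_cols_baseMatrix {b : Fin s} {c : Fin 2 → ZMod (p ^ ((b : ℕ) + 1))} :
    c ∈ (baseMatrix p s).cols b ↔ ∃ a < p, ((b : ℕ) = 0 ∨ a ≠ 0) ∧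
      ![((p ^ (b : ℕ) : ℕ) : ZMod (p ^ ((b : ℕ) + 1))), (a : ZMod (p ^ ((b : ℕ) + 1)))] = c := by
  refine List.mem_map.trans ?_
  simp [and_assoc]

theorem isStandard_baseMatrix (hp : 1 < p) (hs : 2 ≤ s) :
    IsStandard (baseMatrix p s) (fun k => if k = 0 then 1 else s) where
  one_le_m := le_rfl
  exp_zero := rfl
  exp_one := rfl
  one_le_exp k := by split_ifs <;> omega
  exp_le k := by split_ifs <;> omega
  torsion b c hc k := by
    obtain ⟨a, -, -, rfl⟩ := mem_cols_baseMatrix.1 hc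
    have hb := b.2
    revert k
    change ∀ k : Fin 2, _
    intro k
    fin_cases k
    · simp only [Fin.zero_eta, if_true, Matrix.cons_val_zero]
      rw [← Nat.cast_mul, ← pow_add]
      exact natCast_pow_eq_zero (by rw [add_comm])
    · simp only [Fin.mk_one, one_ne_zero, if_false]
      rw [natCast_pow_eq_zero (by omega), zero_mul]
  zero_col b hb := by
    refine mem_cols_baseMatrix.2 ⟨0, by omega, Or.inl hb, ?_⟩
    ext i
    revert i
    change ∀ i : Fin 2, _
    intro i
    fin_cases i <;> simp
  unit_col b k a h1 hk hb ha hap := by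
    obtain rfl : k = 1 := le_antisymm hk h1
    refine mem_cols_baseMatrix.2 ⟨a, hap, Or.inr ha.ne', ?_⟩
    ext i
    revert i
    change ∀ i : Fin 2, _
    intro i
    fin_cases i <;> simp
  pair_col b j h2 hj := absurd (h2.trans hj) (by simp [baseMatrix])
  zero_or_one h2 _ b c hc k hk := by
    obtain ⟨a, ha2, -, rfl⟩ := mem_cols_baseMatrix.1 hc
    subst h2
    obtain rfl : k = (1 : Fin 2) := Fin.ext hk
    interval_cases a <;> simp

/-- Old columns survive with `0` in the new row. The new unit columns come from `zero_col` in block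
`1` and from `M_b` in the other blocks; the new pair column extends the unit column of row `1`. The
hypothesis `he` says that the earlier rows, apart from the first, have at least the order of the new
one. -/
theorem IsStandard.addRow [hp : Fact p.Prime] {A : BlockMatrix p s} {σ : ℕ → ℕ}
    (hA : IsStandard A σ) {e : Fin s} (he : ∀ k, 1 ≤ k → k ≤ A.m → s - e ≤ σ k) :
    IsStandard (addRow e A) (Function.update σ (A.m + 1) (s - e)) := by
  have hes := e.2
  have h1m := hA.one_le_m
  have hp0 := hp.out.pos
  have hσ {k : ℕ} (hk : k ≤ A.m) : Function.update σ (A.m + 1) (s - e) k = σ k :=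
    Function.update_of_ne (by omega) _ _
  have hσ' : Function.update σ (A.m + 1) (s - e) (A.m + 1) = s - e := Function.update_self _ _ _
  have hm : (GHCode.addRow e A).m = A.m + 1 := rfl
  constructor
  · omega
  · rw [hσ (by omega), hA.exp_zero]
  · rw [hσ (by omega), hA.exp_one]
  · intro k
    rcases eq_or_ne k (A.m + 1) with rfl | hk
    · rw [hσ']; omega
    · rw [Function.update_of_ne hk]; exact hA.one_le_exp k
  · intro k
    rcases eq_or_ne k (A.m + 1) with rfl | hk
    · rw [hσ']; omega
    · rw [Function.update_of_ne hk]; exact hA.exp_le k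
  · intro b c hc k
    revert k
    change ∀ k : Fin (A.m + 1 + 1), _
    rcases mem_cols_addRow hc with ⟨z, hz, x, rfl⟩ | ⟨hb, hbe, z, hz, x, rfl⟩ <;> intro k <;>
      refine Fin.lastCases ?_ (fun k => ?_) k
    · simp only [Fin.snoc_last, Fin.val_last, hσ']
      rw [← Nat.cast_mul, ← mul_assoc, ← pow_add, Nat.cast_mul, natCast_pow_eq_zero (by omega),
        zero_mul]
    · simp only [Fin.snoc_castSucc, Fin.val_castSucc, hσ (Nat.lt_succ_iff.1 k.2)]
      exact hA.torsion b z hz k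
    · simp only [Fin.snoc_last, Fin.val_last, hσ']
      rw [natCast_pow_eq_zero (by omega), zero_mul]
    · simp only [Fin.snoc_castSucc, Fin.val_castSucc, hσ (Nat.lt_succ_iff.1 k.2)]
      obtain ⟨h0, h1⟩ := mem_mCols.1 hz
      refine Fin.cases ?_ (fun k => ?_) k
      · rw [h0, ← Nat.cast_mul, ← pow_add, Fin.val_zero, hA.exp_zero]
        exact natCast_pow_eq_zero (by rw [add_comm])
      · obtain ⟨y, -, hy⟩ := h1 k
        -- An entry of `M_b` below the first is a multiple of `p`, hence killed by `p ^ b`, and `b +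
        -- 1 ≤ s - e ≤ σ k`.
        have := he k.succ (by simp) (by simp)
        rw [hy, ← Nat.cast_mul, ← mul_assoc, ← pow_succ, Nat.cast_mul,
          natCast_pow_eq_zero (by omega), zero_mul]
  · intro b hb
    exact hasCol_addRow (hA.zero_col b hb) (x := 0) hp0 (by simp)
  · intro b k a h1 hk hb ha hap
    rcases eq_or_ne k (A.m + 1) with rfl | hk'
    · rw [hσ'] at hb
      by_cases hb0 : (b : ℕ) = 0
      · refine hasCol_addRow (x := a) ?_ hap ?_
        · have := hA.zero_col b hb0
          unfold BlockMatrix.HasCol at this ⊢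
          convert this using 2 with i
          simp [Pi.single_apply, i.2.ne]
        · simp [show (b : ℕ) + 1 - (s - e) = 0 by omega]
      · refine hasCol_addRow_of_lt hb0 (by omega) (by simp) (fun i h1 hi => ?_) ?_ ?_
        · simp [show i ≠ 0 by omega, show i ≠ A.m + 1 by omega]
        · simpa using ha
        · simpa using hap
    · rw [Function.update_of_ne hk'] at hb
      refine hasCol_addRow (hA.unit_col b k a h1 (by omega) hb ha hap) (x := 0) hp0 ?_
      simp [hk'.symm]
  · intro b j h2 hj
    rcases eq_or_ne j (A.m + 1) with rfl | hj'
    · rw [hσ']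
      refine hasCol_addRow (x := 1) ?_ hp.out.one_lt ?_
      · have := hA.unit_col b 1 1 le_rfl h1m (by rw [hA.exp_one]; exact b.2) one_pos hp.out.one_lt
        unfold BlockMatrix.HasCol at this ⊢
        convert this using 2 with i
        simp [Pi.single_apply, i.2.ne]
      · simp [show A.m ≠ 0 by omega]
    · rw [Function.update_of_ne hj']
      refine hasCol_addRow (hA.pair_col b j h2 (by omega)) (x := 0) hp0 ?_
      simp [hj'.symm, show A.m ≠ 0 by omega]
  · intro hp2 hall b c hc k hk
    have hlast := hall (A.m + 1) (by omega) (by omega)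
    rw [hσ'] at hlast
    rcases mem_cols_addRow hc with ⟨z, hz, x, rfl⟩ | ⟨hb, hbe, -⟩
    · have hk' : k = Fin.castSucc (⟨1, by omega⟩ : Fin (A.m + 1)) := Fin.ext hk
      rw [hk', Fin.snoc_castSucc]
      refine hA.zero_or_one hp2 (fun j h2 hj => ?_) b z hz _ rfl
      rw [← hall j h2 (by omega), hσ hj]
    -- Columns from `M_b` need `1 ≤ b` and `b + 1 ≤ s - e`, whereas `s - e = 1` here.
    · omega

theorem exists_isStandard_iterate [Fact p.Prime] {e : Fin s} (n : ℕ) {A : BlockMatrix p s}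
    {σ : ℕ → ℕ} (hA : IsStandard A σ) (he : ∀ k, 1 ≤ k → k ≤ A.m → s - e ≤ σ k) :
    ∃ τ, IsStandard ((addRow e)^[n] A) τ ∧
      ∀ k, 1 ≤ k → k ≤ ((addRow e)^[n] A).m → s - e ≤ τ k := by
  induction n with
  | zero => exact ⟨σ, hA, he⟩
  | succ n ih =>
    obtain ⟨τ, h1, h2⟩ := ih
    rw [Function.iterate_succ_apply']
    refine ⟨_, h1.addRow h2, fun k hk hkm => ?_⟩
    rcases eq_or_ne k (((addRow e)^[n] A).m + 1) with rfl | hk'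
    · rw [Function.update_self]
    · rw [Function.update_of_ne hk']
      exact h2 k hk (Nat.le_of_lt_succ (lt_of_le_of_ne hkm hk'))

theorem exists_isStandard_foldl [Fact p.Prime] (n : Fin s → ℕ) :
    ∀ (l : List (Fin s)) (A : BlockMatrix p s) (σ : ℕ → ℕ), l.Pairwise (· ≤ ·) →
      IsStandard A σ → (∀ e ∈ l, ∀ k, 1 ≤ k → k ≤ A.m → s - e ≤ σ k) →
      ∃ τ, IsStandard (l.foldl (fun A e => (addRow e)^[n e] A) A) τ
  | [], _, σ, _, hA, _ => ⟨σ, hA⟩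
  | e :: l, A, σ, hl, hA, he => by
    obtain ⟨τ, h1, h2⟩ := exists_isStandard_iterate (n e) hA (he e (by simp))
    refine exists_isStandard_foldl n l _ τ (List.pairwise_cons.1 hl).2 h1 fun e' he' k hk hkm => ?_
    have : (e : ℕ) ≤ e' := (List.pairwise_cons.1 hl).1 e' he'
    have := h2 k hk hkm
    omega

theorem exists_isStandard_genMatrix [hp : Fact p.Prime] (hs : 2 ≤ s) (t : Fin s → ℕ) :
    ∃ σ, IsStandard (genMatrix p t) σ := by
  refine exists_isStandard_foldl _ _ _ _ ?_ (isStandard_baseMatrix hp.out.one_lt hs) ?_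
  · exact (List.pairwise_lt_finRange s).imp fun h => h.le
  · intro e _ k hk _
    simp [show k ≠ 0 by omega]

theorem m_foldl_addRow (n : Fin s → ℕ) : ∀ (l : List (Fin s)) (A : BlockMatrix p s),
    (l.foldl (fun A e => (addRow e)^[n e] A) A).m = A.m + (l.map n).sum
  | [], _ => rfl
  | e :: l, A => by
    have h : ∀ k, ((addRow e)^[k] A).m = A.m + k := fun k => by
      induction k with
      | zero => rfl
      | succ k ih => rw [Function.iterate_succ_apply', ← add_assoc, ← ih]; rfl
    rw [List.foldl_cons, m_foldl_addRow n l, h, List.map_cons, List.sum_cons, add_assoc]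

theorem rows_genMatrix (p : ℕ) (hs : 2 ≤ s) (t : Fin s → ℕ) {i₀ i₁ : Fin s} (hi₀ : (i₀ : ℕ) = 0)
    (hi₁ : (i₁ : ℕ) + 1 = s) (h0 : 1 ≤ t i₀) (h1 : 1 ≤ t i₁) :
    (genMatrix p t).rows = ∑ i, t i := by
  have hne : i₀ ≠ i₁ := by
    rintro rfl
    omega
  -- The two units subtracted from the first and last `t` are the two rows of the base matrix; the
  -- indices differ because `2 ≤ s`.
  have key : ∑ i, t i = ∑ i : Fin s, (if (i : ℕ) = 0 ∨ (i : ℕ) + 1 = s then t i - 1 else t i) +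
      ∑ i : Fin s, ((if i = i₀ then 1 else 0) + if i = i₁ then 1 else 0) := by
    rw [← Finset.sum_add_distrib]
    refine Finset.sum_congr rfl fun i _ => ?_
    rcases eq_or_ne i i₀ with rfl | hi0
    · rw [if_pos (Or.inl hi₀), if_pos rfl, if_neg hne]
      omega
    · rcases eq_or_ne i i₁ with rfl | hi1
      · rw [if_pos (Or.inr hi₁), if_neg hne.symm, if_pos rfl]
        omega
      · have : (i : ℕ) ≠ 0 := fun h => hi0 (Fin.ext (h.trans hi₀.symm))
        have : (i : ℕ) + 1 ≠ s := fun h => hi1 (Fin.ext (by omega))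
        rw [if_neg (by omega), if_neg hi0, if_neg hi1]
        rfl
  rw [key, BlockMatrix.rows, genMatrix, m_foldl_addRow, Finset.sum_add_distrib,
    Finset.sum_ite_eq', Finset.sum_ite_eq', Fin.sum_univ_def]
  simp [baseMatrix]
  omega

end Columns

/-! ### Codewords with natural coefficients -/

section Words

variable {p s : ℕ}

/-- The combination of the rows of `A` with coefficients `n 0, n 1, …`. -/
def BlockMatrix.word (A : BlockMatrix p s) (n : ℕ → ℕ) : Mixed p A.width :=
  ∑ k : Fin (A.m + 1), n k • A.row k

theorem BlockMatrix.word_apply (A : BlockMatrix p s) (n : ℕ → ℕ) (b : Fin s) (i : Fin (A.width b)) :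
    A.word n b i = ∑ k : Fin (A.m + 1), (n k : ZMod (p ^ ((b : ℕ) + 1))) * (A.cols b).get i k := by
  simp [BlockMatrix.word, BlockMatrix.row, Finset.sum_apply]

theorem BlockMatrix.word_add (A : BlockMatrix p s) (m n : ℕ → ℕ) :
    A.word (m + n) = A.word m + A.word n := by
  simp [BlockMatrix.word, add_smul, Finset.sum_add_distrib]

theorem BlockMatrix.word_single (A : BlockMatrix p s) (k : Fin A.rows) (a : ℕ) :
    A.word (Pi.single (k : ℕ) a) = a • A.row k := by
  rw [BlockMatrix.word, Finset.sum_eq_single k]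
  · simp
  · intro i _ hi
    simp [show (i : ℕ) ≠ k from fun h => hi (Fin.ext h)]
  · simp

theorem BlockMatrix.word_mem_code (A : BlockMatrix p s) (n : ℕ → ℕ) : A.word n ∈ A.code :=
  sum_mem fun k _ => nsmul_mem (AddSubgroup.subset_closure (Set.mem_range_self k)) _

theorem pow_nsmul_eq_zero {α : Fin s → ℕ} (x : Mixed p α) : p ^ s • x = 0 := by
  ext b i
  simp only [Pi.smul_apply, nsmul_eq_mul, Pi.zero_apply]
  rw [natCast_pow_eq_zero (by omega), zero_mul]

/-- Natural coefficients suffice because `p ^ s` kills everything, so negation is multiplication by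
`p ^ s - 1`. Digits can then be read off natural numbers. -/
theorem BlockMatrix.mem_code_iff (hp : 0 < p) {A : BlockMatrix p s} {x : Mixed p A.width} :
    x ∈ A.code ↔ ∃ n, A.word n = x := by
  refine ⟨fun hx => ?_, ?_⟩
  · refine AddSubgroup.closure_induction ?_ ?_ ?_ ?_ hx
    · rintro _ ⟨k, rfl⟩
      exact ⟨Pi.single (k : ℕ) 1, by rw [A.word_single, one_smul]⟩
    · exact ⟨0, by simp [BlockMatrix.word]⟩
    · rintro _ _ _ _ ⟨m, rfl⟩ ⟨n, rfl⟩
      exact ⟨m + n, A.word_add m n⟩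
    · rintro _ _ ⟨n, rfl⟩
      refine ⟨fun k => (p ^ s - 1) * n k, ?_⟩
      have h : A.word (fun k => (p ^ s - 1) * n k) = (p ^ s - 1) • A.word n := by
        simp [BlockMatrix.word, Finset.smul_sum, mul_smul]
      rw [h, eq_neg_iff_add_eq_zero, ← succ_nsmul, Nat.sub_add_cancel (pow_pos hp s),
        pow_nsmul_eq_zero]
  · rintro ⟨n, rfl⟩
    exact A.word_mem_code n

theorem Gray_zero {α : Fin s → ℕ} : Gray (0 : Mixed p α) = 0 := by
  ext c
  exact gray_zero _ _ _

/-- The value of the word with coefficients `n` at a column with natural entries. -/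
theorem BlockMatrix.exists_index {A : BlockMatrix p s} {b : Fin s} {z : ℕ → ℕ} (hz : A.HasCol b z) :
    ∃ i : Fin (A.width b), ∀ n, A.word n b i =
      ((∑ k ∈ Finset.range (A.m + 1), n k * z k : ℕ) : ZMod (p ^ ((b : ℕ) + 1))) := by
  obtain ⟨i, hi⟩ := List.mem_iff_get.1 hz
  refine ⟨i, fun n => ?_⟩
  rw [A.word_apply, hi, ← Fin.sum_univ_eq_sum_range fun k => n k * z k]
  push_cast
  rfl

variable [hp : Fact p.Prime]

theorem Gray_add_of_torsion {α : Fin s → ℕ} {x : Mixed p α} (hx : p • x = 0) (y : Mixed p α) :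
    Gray (x + y) = Gray x + Gray y := by
  ext ⟨b, i, j⟩
  refine gray_add_of_torsion ?_ _ _
  have := congrFun (congrFun hx b) i
  simpa using this

theorem Gray_nsmul_of_torsion {α : Fin s → ℕ} {x : Mixed p α} (hx : p • x = 0) (n : ℕ) :
    Gray (n • x) = n • Gray x := by
  induction n with
  | zero => simp [Gray_zero]
  | succ n ih => rw [succ_nsmul', succ_nsmul', Gray_add_of_torsion hx, ih]

theorem Gray_sum_of_torsion {α : Fin s → ℕ} {ι : Type*} (S : Finset ι) {x : ι → Mixed p α}
    (hx : ∀ k ∈ S, p • x k = 0) : Gray (∑ k ∈ S, x k) = ∑ k ∈ S, Gray (x k) := by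
  classical
  induction S using Finset.induction_on with
  | empty => simp [Gray_zero]
  | insert k S hk ih =>
    rw [Finset.sum_insert hk, Finset.sum_insert hk, Gray_add_of_torsion (hx k (by simp)),
      ih fun i hi => hx i (by simp [hi])]

theorem digit_sum_of_Gray_add {A : BlockMatrix p s} {u v w : ℕ → ℕ}
    (h : Gray (A.word w) = Gray (A.word u) + Gray (A.word v)) {b : Fin s} {z : ℕ → ℕ}
    (hz : A.HasCol b z) {l : ℕ} (hl : l ≤ b) :
    digit p l (∑ k ∈ Finset.range (A.m + 1), w k * z k) =
      digit p l (∑ k ∈ Finset.range (A.m + 1), u k * z k) +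
      digit p l (∑ k ∈ Finset.range (A.m + 1), v k * z k) := by
  obtain ⟨i, hi⟩ := A.exists_index hz
  have := digit_add_of_gray (u := A.word u b i) (v := A.word v b i) (w := A.word w b i)
    (fun y => congrFun h ⟨b, i, y⟩) hl
  rwa [hi, hi, hi, digit_val_natCast hl, digit_val_natCast hl, digit_val_natCast hl] at this

theorem sum_mul_single {m k : ℕ} (hk : k ≤ m) (n : ℕ → ℕ) (a : ℕ) :
    ∑ i ∈ Finset.range (m + 1), n i * (Pi.single k a : ℕ → ℕ) i = n k * a := by
  rw [Finset.sum_eq_single k]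
  · simp
  · intro i _ hi
    simp [hi]
  · intro h
    exact absurd (Finset.mem_range.2 (by omega)) h

/-! ### Digit constraints read off the distinguished columns -/

section IsStandard

variable {A : BlockMatrix p s} {σ : ℕ → ℕ} (hA : IsStandard A σ) {u v w : ℕ → ℕ}
include hA

theorem IsStandard.natCast_zero (h : Gray (A.word w) = Gray (A.word u) + Gray (A.word v)) :
    (w 0 : ZMod p) = u 0 + v 0 := by
  have hs : 0 < s := hA.exp_one ▸ hA.one_le_exp 1
  have := digit_sum_of_Gray_add h (hA.zero_col ⟨0, hs⟩ rfl) (l := 0) le_rfl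
  simpa [sum_mul_single, digit_zero_left] using this

/-- The first entry `p ^ b` contributes additively to digit `b` and to no lower digit, so
`natCast_zero` removes it. -/
theorem IsStandard.digit_col (h : Gray (A.word w) = Gray (A.word u) + Gray (A.word v))
    {b : Fin s} {z : ℕ → ℕ} (hz : A.HasCol b (Pi.single 0 (p ^ (b : ℕ)) + z)) {l : ℕ}
    (hl : l ≤ b) :
    digit p l (∑ k ∈ Finset.range (A.m + 1), w k * z k) =
      digit p l (∑ k ∈ Finset.range (A.m + 1), u k * z k) +
      digit p l (∑ k ∈ Finset.range (A.m + 1), v k * z k) := by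
  have h0 := hA.natCast_zero h
  have := digit_sum_of_Gray_add h hz hl
  simp only [Pi.add_apply, mul_add, Finset.sum_add_distrib, sum_mul_single (Nat.zero_le _),
    digit_mul_pow_add hp.out.pos hl] at this
  split_ifs at this
  · linear_combination this - h0
  · simpa using this

theorem IsStandard.digit_unit_col (h : Gray (A.word w) = Gray (A.word u) + Gray (A.word v))
    {k a b l : ℕ} (h1 : 1 ≤ k) (hk : k ≤ A.m) (hb : b < σ k) (ha : 0 < a) (hap : a < p)
    (hl : l ≤ b) : digit p l (w k * a) = digit p l (u k * a) + digit p l (v k * a) := by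
  have hbs : b < s := hb.trans_le (hA.exp_le k)
  have := hA.digit_col h (hA.unit_col ⟨b, hbs⟩ k a h1 hk hb ha hap) hl
  simpa only [sum_mul_single hk] using this

theorem IsStandard.digit_pair_col (h : Gray (A.word w) = Gray (A.word u) + Gray (A.word v))
    {j b l : ℕ} (h2 : 2 ≤ j) (hj : j ≤ A.m) (hb : b < s) (hl : l ≤ b) :
    digit p l (w 1 + w j * p ^ (b + 1 - σ j)) = digit p l (u 1 + u j * p ^ (b + 1 - σ j)) +
      digit p l (v 1 + v j * p ^ (b + 1 - σ j)) := by
  have hz := hA.pair_col ⟨b, hb⟩ j h2 hj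
  rw [add_assoc] at hz
  have := hA.digit_col h hz hl
  simpa only [Pi.add_apply, mul_add, Finset.sum_add_distrib, sum_mul_single hA.one_le_m,
    sum_mul_single hj, mul_one] using this

/-- Otherwise `u k = p ^ e * l` with `p ∤ l` and `e + 1 < σ k`. The column with entry `1` forces `w
k = p ^ e * n`, the two lowest digits of `n` being twice those of `l`. The column with entry `p - 1`
contradicts this. -/
theorem IsStandard.dvd_of_Gray_double (hp2 : p ≠ 2)
    (h : Gray (A.word w) = Gray (A.word u) + Gray (A.word u)) {k : ℕ} (h1 : 1 ≤ k) (hk : k ≤ A.m) :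
    p ^ (σ k - 1) ∣ u k := by
  have hpp := hp.out.pos
  have hp1 := hp.out.one_lt
  by_contra hdvd
  obtain ⟨e, l, hl, hul⟩ := Nat.exists_eq_pow_mul_and_not_dvd
    (fun h => hdvd (h ▸ dvd_zero _) : u k ≠ 0) p hp.out.ne_one
  have he : e + 1 < σ k := by
    by_contra he
    exact hdvd (hul ▸ (pow_dvd_pow p (by omega)).mul_right l)
  have H (a : ℕ) (ha : 0 < a) (hap : a < p) (i : ℕ) (hi : i ≤ e + 1) :=
    hA.digit_unit_col h h1 hk he ha hap hi
  obtain ⟨n, hn⟩ : p ^ e ∣ w k := pow_dvd_of_digit_eq_zero hpp fun i hi => by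
    have := H 1 one_pos hp1 i (by omega)
    rw [mul_one, mul_one] at this
    rw [this, hul, digit_pow_mul_of_lt hi, add_zero]
  have H' (a : ℕ) (ha : 0 < a) (hap : a < p) (i : ℕ) (hi : i ≤ 1) :
      digit p i (n * a) = digit p i (l * a) + digit p i (l * a) := by
    have := H a ha hap (e + i) (by omega)
    rwa [hn, hul, mul_assoc, mul_assoc, digit_pow_mul hpp, digit_pow_mul hpp] at this
  have hn0 := H' 1 one_pos hp1 0 (by omega)
  have hn1 := H' 1 one_pos hp1 1 le_rfl
  have hnp := H' (p - 1) (by omega) (by omega) 1 le_rfl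
  simp only [mul_one, digit_zero_left] at hn0 hn1
  have hndvd : ¬p ∣ n := by
    rw [← ZMod.natCast_eq_zero_iff, hn0, ← two_mul, mul_eq_zero, not_or,
      ZMod.natCast_eq_zero_iff]
    refine ⟨fun h2 => hp2 ?_, hl⟩
    rw [show (2 : ZMod p) = ((2 : ℕ) : ZMod p) by norm_cast, ZMod.natCast_eq_zero_iff] at h2
    exact (Nat.prime_dvd_prime_iff_eq hp.out Nat.prime_two).1 h2
  -- With `l₀, l₁` the low digits of `l`, the left side is `2 l₀ - 2 l₁ - 1` and the right side is
  -- `2 (l₀ - l₁ - 1)`.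
  rw [digit_one_pred_mul hpp hndvd, digit_one_pred_mul hpp hl, digit_zero_left, digit_zero_left,
    hn0, hn1] at hnp
  exact one_ne_zero (α := ZMod p) (by linear_combination hnp)

end IsStandard

end Words

/-! ### The kernel: divisibility, the linear case and the basis -/

section Kernel

variable {p s : ℕ}

/-- Both `a` and `a'` have lowest set bit `e`, so bit `e` of the other summand is the carry into bit
`e + 1`. That bit differs for `y` and `z`, while all other contributions agree. -/
theorem binary_carry_ne {e l a a' y z : ℕ} (hl : ¬2 ∣ l) (ha : a = 2 ^ e * l)
    (haa : ∀ i ≤ e + 1, digit 2 i a' = digit 2 i a) (hz : digit 2 e z = digit 2 e y + 1)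
    (hz' : digit 2 (e + 1) z = digit 2 (e + 1) y) :
    digit 2 (e + 1) (a' + z) ≠ digit 2 (e + 1) (a + y) := by
  obtain ⟨n, rfl⟩ : 2 ^ e ∣ a' := pow_dvd_of_digit_eq_zero two_pos fun i hi => by
    rw [haa i (by omega), ha, digit_pow_mul_of_lt hi]
  subst ha
  have h0 := haa e (by omega)
  rw [show digit 2 e (2 ^ e * n) = _ from digit_pow_mul two_pos e 0 n,
    show digit 2 e (2 ^ e * l) = _ from digit_pow_mul two_pos e 0 l, digit_zero_left,
    digit_zero_left] at h0
  have hn : ¬2 ∣ n := by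
    rwa [← ZMod.natCast_eq_zero_iff, h0, ZMod.natCast_eq_zero_iff]
  rw [digit_two_succ_add hn, digit_two_succ_add hl, haa _ le_rfl, hz, hz']
  intro h
  exact one_ne_zero (α := ZMod 2) (by linear_combination h)

/-- If `2 ^ e` exactly divides `u k` and `e + 1 < σ k`, add `2 ^ e` times row `1`. This flips bit
`e` of the row `1` coefficient without a carry, and the pair column of rows `1` and `k` in the block
over `ℤ/2^(e+2)` detects the missing carry. -/
theorem IsStandard.two_pow_dvd {A : BlockMatrix 2 s} {σ : ℕ → ℕ} (hA : IsStandard A σ) {u : ℕ → ℕ}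
    (H : ∀ v, ∃ w, Gray (A.word w) = Gray (A.word u) + Gray (A.word v)) {k : ℕ} (h2 : 2 ≤ k)
    (hk : k ≤ A.m) : 2 ^ (σ k - 1) ∣ u k := by
  by_contra hdvd
  obtain ⟨e, l, hl, hul⟩ := Nat.exists_eq_pow_mul_and_not_dvd
    (fun h => hdvd (h ▸ dvd_zero _) : u k ≠ 0) 2 (by norm_num)
  have he : e + 1 < σ k := by
    by_contra he
    exact hdvd (hul ▸ (pow_dvd_pow 2 (by omega)).mul_right l)
  have hes : e + 1 < s := he.trans_le (hA.exp_le k)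
  obtain ⟨w, hw⟩ := H (Pi.single 1 (2 ^ e))
  have hd (i : ℕ) (hi : i ≤ e + 1) := hA.digit_unit_col hw le_rfl hA.one_le_m
    (hA.exp_one.symm ▸ hes) one_pos one_lt_two hi
  simp only [mul_one, Pi.single_eq_same, digit_pow one_lt_two] at hd
  refine binary_carry_ne (a := u k) (a' := w k) (y := u 1) (z := w 1) hl hul (fun i hi => ?_) ?_ ?_ ?_
  · have := hA.digit_unit_col hw (by omega) hk he one_pos one_lt_two hi
    simpa [show k ≠ 1 by omega, digit_zero_right] using this
  · simpa using hd e (by omega)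
  · simpa using hd (e + 1) le_rfl
  · have := hA.digit_pair_col hw h2 hk hes le_rfl
    rw [show e + 1 + 1 - σ k = 0 by omega] at this
    simpa [show k ≠ 1 by omega, digit_pow one_lt_two, add_comm] using this

/-- The same argument with the roles exchanged: a multiple of row `j` is added to expose the
coefficient of row `1`. -/
theorem IsStandard.two_pow_dvd_one {A : BlockMatrix 2 s} {σ : ℕ → ℕ} (hA : IsStandard A σ)
    {u : ℕ → ℕ} (H : ∀ v, ∃ w, Gray (A.word w) = Gray (A.word u) + Gray (A.word v)) {j : ℕ}
    (h2 : 2 ≤ j) (hj : j ≤ A.m) (hσ : 2 ≤ σ j) : 2 ^ (s - 1) ∣ u 1 := by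
  by_contra hdvd
  obtain ⟨e, l, hl, hul⟩ := Nat.exists_eq_pow_mul_and_not_dvd
    (fun h => hdvd (h ▸ dvd_zero _) : u 1 ≠ 0) 2 (by norm_num)
  have hes : e + 1 < s := by
    by_contra he
    exact hdvd (hul ▸ (pow_dvd_pow 2 (by omega)).mul_right l)
  -- The pair column has entry `2 ^ d` in row `j`, so the coefficient `2 ^ r` shows up there as `2 ^
  -- e`. The condition `2 ≤ σ j` ensures `r + 1 < σ j`, so that unit columns control bits `r` and `r
  -- + 1` of `w j`.
  obtain ⟨r, d, hr, hd, hrσ⟩ : ∃ r d, d + r = e ∧ e + 1 + 1 - σ j = d ∧ r + 1 < σ j := by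
    rcases le_total (σ j) (e + 2) with h | h
    · exact ⟨σ j - 2, e + 2 - σ j, by omega, rfl, by omega⟩
    · exact ⟨e, 0, by omega, by omega, by omega⟩
  obtain ⟨w, hw⟩ := H (Pi.single j (2 ^ r))
  have hdig (i : ℕ) (hi : i ≤ r + 1) :
      digit 2 (d + i) (w j * 2 ^ d) = digit 2 (d + i) (u j * 2 ^ d) + if i = r then 1 else 0 := by
    have := hA.digit_unit_col hw (by omega) hj hrσ one_pos one_lt_two hi
    simpa only [mul_one, Pi.single_eq_same, digit_pow one_lt_two, mul_comm _ (2 ^ d),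
      digit_pow_mul two_pos] using this
  refine binary_carry_ne (a := u 1) (a' := w 1) (y := u j * 2 ^ d) (z := w j * 2 ^ d) hl hul
    (fun i hi => ?_) ?_ ?_ ?_
  · have := hA.digit_unit_col hw le_rfl hA.one_le_m (hA.exp_one.symm ▸ hes) one_pos one_lt_two hi
    simpa [show 1 ≠ j by omega, digit_zero_right] using this
  · simpa [hr] using hdig r (by omega)
  · simpa [hr, ← add_assoc] using hdig (r + 1) le_rfl
  · have := hA.digit_pair_col hw h2 hj hes le_rfl
    rw [hd, Pi.single_eq_same, Pi.single_eq_of_ne (show 1 ≠ j by omega), zero_add, ← pow_add,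
      add_comm r, hr, digit_pow one_lt_two, if_neg (by omega), add_zero] at this
    exact this

theorem IsStandard.pow_nsmul_row {A : BlockMatrix p s} {σ : ℕ → ℕ}
    (hA : IsStandard A σ) (k : Fin A.rows) : p ^ σ k • A.row k = 0 := by
  ext b i
  have := hA.torsion b _ (List.get_mem _ i) k
  simpa [BlockMatrix.row] using this

theorem IsStandard.nsmul_pow_nsmul_row {A : BlockMatrix p s} {σ : ℕ → ℕ}
    (hA : IsStandard A σ) (k : Fin A.rows) : p • p ^ (σ k - 1) • A.row k = 0 := by
  rw [smul_smul, ← pow_succ', Nat.sub_add_cancel (hA.one_le_exp k), hA.pow_nsmul_row]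

variable [hp : Fact p.Prime]

theorem IsStandard.pow_dvd {A : BlockMatrix p s} {σ : ℕ → ℕ} (hA : IsStandard A σ)
    (hnl : ¬(p = 2 ∧ ∀ j, 2 ≤ j → j ≤ A.m → σ j = 1)) {u : ℕ → ℕ}
    (H : ∀ v, ∃ w, Gray (A.word w) = Gray (A.word u) + Gray (A.word v)) {k : ℕ} (hk : k ≤ A.m) :
    p ^ (σ k - 1) ∣ u k := by
  rcases Nat.eq_zero_or_pos k with rfl | h1
  · simp [hA.exp_zero]
  by_cases hp2 : p = 2
  · subst hp2
    rcases Nat.lt_or_ge 1 k with h2 | h2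
    · exact hA.two_pow_dvd H h2 hk
    · obtain rfl : k = 1 := by omega
      simp only [true_and, not_forall] at hnl
      obtain ⟨j, h2, hj, hσ⟩ := hnl
      rw [hA.exp_one]
      exact hA.two_pow_dvd_one H h2 hj (by have := hA.one_le_exp j; omega)
  · obtain ⟨w, hw⟩ := H u
    exact hA.dvd_of_Gray_double hp2 hw h1 hk

theorem isLinearCode_of_add_mem {ι : Type} {C : Set (ι → ZMod p)} (h0 : 0 ∈ C)
    (h : ∀ x ∈ C, ∀ y ∈ C, x + y ∈ C) : IsLinearCode C := by
  suffices hsmul : ∀ (c : ZMod p), ∀ x ∈ C, c • x ∈ C from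
    ⟨⟨⟨⟨C, fun hx hy => h _ hx _ hy⟩, h0⟩, fun c x hx => hsmul c x hx⟩, rfl⟩
  intro c x hx
  rw [← ZMod.natCast_zmod_val c, Nat.cast_smul_eq_nsmul]
  induction c.val with
  | zero => simpa using h0
  | succ n ih => rw [succ_nsmul]; exact h _ ih _ hx

/-- All rows but that of index `1` have order `2`, so `Φ` is additive on them. The entries of row
`1` are `0` or `1`, so there the Gray sum comes from the bitwise XOR of the two coefficients. -/
theorem IsStandard.isLinearCode {A : BlockMatrix 2 s} {σ : ℕ → ℕ} (hA : IsStandard A σ)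
    (hσ : ∀ j, 2 ≤ j → j ≤ A.m → σ j = 1) :
    IsLinearCode (Gray '' (A.code : Set (Mixed 2 A.width))) := by
  have h1m := hA.one_le_m
  refine isLinearCode_of_add_mem ⟨0, A.code.zero_mem, Gray_zero⟩ ?_
  rintro _ ⟨x, hx, rfl⟩ _ ⟨y, hy, rfl⟩
  obtain ⟨m, rfl⟩ := (BlockMatrix.mem_code_iff two_pos).1 hx
  obtain ⟨n, rfl⟩ := (BlockMatrix.mem_code_iff two_pos).1 hy
  refine ⟨A.word (Function.update (m + n) 1 (m 1 ^^^ n 1)), A.word_mem_code _, ?_⟩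
  let q : Fin (A.m + 1) := ⟨1, by omega⟩
  ext ⟨b, i, c⟩
  have hval (f : ℕ → ℕ) : A.word f b i =
      (∑ k ∈ Finset.univ.erase q, (f k : ZMod (2 ^ ((b : ℕ) + 1))) * (A.cols b).get i k) +
        f 1 * (A.cols b).get i q := by
    rw [A.word_apply]
    exact (Finset.sum_erase_add _ _ (Finset.mem_univ q)).symm
  have htor (f : ℕ → ℕ) : ((2 : ℕ) : ZMod (2 ^ ((b : ℕ) + 1))) * (∑ k ∈ Finset.univ.erase q,
      (f k : ZMod (2 ^ ((b : ℕ) + 1))) * (A.cols b).get i k) = 0 := by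
    rw [Finset.mul_sum]
    refine Finset.sum_eq_zero fun k hk => ?_
    have hk1 : (k : ℕ) ≠ 1 := fun h => Finset.ne_of_mem_erase hk (Fin.ext h)
    have hσk : σ k = 1 := by
      rcases Nat.eq_zero_or_pos (k : ℕ) with h | h
      · rw [h, hA.exp_zero]
      · exact hσ k (by omega) (by omega)
    have := hA.torsion b _ (List.get_mem _ i) k
    rw [hσk, pow_one] at this
    rw [mul_left_comm, this, mul_zero]
  have hupd : ∑ k ∈ Finset.univ.erase q, ((Function.update (m + n) 1 (m 1 ^^^ n 1) k : ℕ) :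
      ZMod (2 ^ ((b : ℕ) + 1))) * (A.cols b).get i k =
      ∑ k ∈ Finset.univ.erase q, (m k : ZMod (2 ^ ((b : ℕ) + 1))) * (A.cols b).get i k +
      ∑ k ∈ Finset.univ.erase q, (n k : ZMod (2 ^ ((b : ℕ) + 1))) * (A.cols b).get i k := by
    rw [← Finset.sum_add_distrib]
    refine Finset.sum_congr rfl fun k hk => ?_
    have hk1 : (k : ℕ) ≠ 1 := fun h => Finset.ne_of_mem_erase hk (Fin.ext h)
    rw [Function.update_of_ne hk1, Pi.add_apply, Nat.cast_add, add_mul]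
  change gray 2 b (A.word _ b i) c = gray 2 b (A.word m b i) c + gray 2 b (A.word n b i) c
  rw [hval, hval, hval, hupd, add_assoc, gray_add_of_torsion (htor m), gray_add_of_torsion (htor n),
    gray_add_of_torsion (htor m), gray_add_of_torsion (htor n), Function.update_self]
  have hxor : gray 2 b (((m 1 ^^^ n 1 : ℕ) : ZMod (2 ^ ((b : ℕ) + 1))) * (A.cols b).get i q) c =
      gray 2 b ((m 1 : ZMod (2 ^ ((b : ℕ) + 1))) * (A.cols b).get i q) c +
      gray 2 b ((n 1 : ZMod (2 ^ ((b : ℕ) + 1))) * (A.cols b).get i q) c := by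
    rcases hA.zero_or_one rfl hσ b _ (List.get_mem _ i) q rfl with h | h
    · rw [h, mul_zero, mul_zero, mul_zero, gray_zero, add_zero]
    · rw [h, mul_one, mul_one, mul_one]
      exact gray_of_digit_add (fun l _ => digit_two_xor l _ _) c
  rw [hxor]
  ring

/-! ### Independence, spanning and the basis -/

section Basis

variable {A : BlockMatrix p s} {σ : ℕ → ℕ} (hA : IsStandard A σ)
include hA

theorem IsStandard.exists_coordinate (j : Fin A.rows) : ∃ c : GrayIdx p A.width, ∀ k : Fin A.rows,
    Gray (p ^ (σ k - 1) • A.row k) c = if k = 0 ∨ k = j then 1 else 0 := by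
  have key : ∃ (b : Fin s) (z : ℕ → ℕ), A.HasCol b z ∧ ∀ k : Fin A.rows,
      p ^ (σ k - 1) * z k = (if k = 0 ∨ k = j then 1 else 0) * p ^ (b : ℕ) := by
    rcases eq_or_ne j 0 with rfl | hj
    · refine ⟨⟨0, hA.exp_one ▸ hA.one_le_exp 1⟩, _, hA.zero_col _ rfl, fun k => ?_⟩
      rcases eq_or_ne k 0 with rfl | hk
      · simp [hA.exp_zero]
      · simp [hk]
    · have hσj := hA.one_le_exp j
      have hj0 : (j : ℕ) ≠ 0 := fun h => hj (Fin.ext h)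
      -- In block index `b = σ j - 1` the multiple `p ^ (σ j - 1)` of the unit entry is `p ^ b`,
      -- whose Gray image is constantly `1`; the first row contributes `p ^ b` too.
      refine ⟨⟨σ j - 1, by have := hA.exp_le j; omega⟩, _, hA.unit_col _ j 1 (by omega)
        (Nat.lt_succ_iff.1 j.2) (by simp; omega) one_pos hp.out.one_lt, fun k => ?_⟩
      rcases eq_or_ne k 0 with rfl | hk
      · simp [hA.exp_zero, hj0.symm]
      · have hk0 : (k : ℕ) ≠ 0 := fun h => hk (Fin.ext h)
        rcases eq_or_ne k j with rfl | hkj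
        · simp [hk0]
        · simp [hk, hkj, hk0, show (k : ℕ) ≠ j from fun h => hkj (Fin.ext h)]
  obtain ⟨b, z, hz, hval⟩ := key
  obtain ⟨i, hi⟩ := A.exists_index hz
  refine ⟨⟨b, i, ⟨0, pow_pos hp.out.pos _⟩⟩, fun k => ?_⟩
  rw [← A.word_single]
  change gray p b (A.word _ b i) _ = _
  rw [hi, Finset.sum_eq_single (k : ℕ), Pi.single_eq_same, hval, gray_natCast_mul_pow]
  · split_ifs <;> simp
  · intro x _ hx
    simp [hx]
  · intro h
    exact absurd (Finset.mem_range.2 k.2) h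

theorem IsStandard.addOrderOf_row (k : Fin A.rows) : addOrderOf (A.row k) = p ^ σ k := by
  have h := Nat.sub_add_cancel (hA.one_le_exp k)
  rw [← h]
  refine addOrderOf_eq_prime_pow (fun h0 => ?_) (by rw [h]; exact hA.pow_nsmul_row k)
  obtain ⟨c, hc⟩ := hA.exists_coordinate k
  have := hc k
  rw [h0, Gray_zero] at this
  simp at this

theorem IsStandard.addOrderOf_row_div (k : Fin A.rows) :
    addOrderOf (A.row k) / p = p ^ (σ k - 1) := by
  rw [hA.addOrderOf_row, ← Nat.sub_add_cancel (hA.one_le_exp k), pow_succ,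
    Nat.mul_div_cancel _ hp.out.pos, Nat.add_sub_cancel]

theorem IsStandard.linearIndependent :
    LinearIndependent (ZMod p) fun k : Fin A.rows => Gray (p ^ (σ k - 1) • A.row k) := by
  rw [Fintype.linearIndependent_iff]
  intro g hg
  have hsum (j : Fin A.rows) : ∑ k, g k * (if k = 0 ∨ k = j then 1 else 0) = 0 := by
    obtain ⟨c, hc⟩ := hA.exists_coordinate j
    have := congrFun hg c
    simpa only [Finset.sum_apply, Pi.smul_apply, smul_eq_mul, hc, Pi.zero_apply] using this
  have h0 : g 0 = 0 := by
    simpa using hsum 0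
  intro j
  have := hsum j
  rwa [Finset.sum_eq_single j, if_pos (Or.inr rfl), mul_one] at this
  · intro k _ hk
    rcases eq_or_ne k 0 with rfl | hk0
    · rw [h0, zero_mul]
    · simp [hk, hk0]
  · simp

theorem IsStandard.Gray_mem_kernel (k : Fin A.rows) : Gray (p ^ (σ k - 1) • A.row k) ∈
    kernel (Gray '' (A.code : Set (Mixed p A.width))) := by
  have hadd := Gray_add_of_torsion (hA.nsmul_pow_nsmul_row k)
  have hmem : p ^ (σ k - 1) • A.row k ∈ A.code :=
    nsmul_mem (AddSubgroup.subset_closure (Set.mem_range_self k)) _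
  rw [mem_kernel]
  ext x
  constructor
  · rintro ⟨_, ⟨y, hy, rfl⟩, rfl⟩
    exact ⟨_, A.code.add_mem hmem hy, hadd y⟩
  · rintro ⟨y, hy, rfl⟩
    refine ⟨_, ⟨_, A.code.sub_mem hy hmem, rfl⟩, ?_⟩
    simp only [← hadd, add_sub_cancel]

theorem IsStandard.kernel_le_span
    (hnl : ¬IsLinearCode (Gray '' (A.code : Set (Mixed p A.width)))) :
    kernel (Gray '' (A.code : Set (Mixed p A.width))) ≤
      Submodule.span (ZMod p) (Set.range fun k : Fin A.rows => Gray (p ^ (σ k - 1) • A.row k)) := by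
  intro x hx
  rw [mem_kernel] at hx
  -- The code contains `0`, so every kernel element is itself a codeword.
  obtain ⟨y, hy, rfl⟩ : x ∈ Gray '' (A.code : Set (Mixed p A.width)) := by
    rw [← hx]
    exact ⟨0, ⟨0, A.code.zero_mem, Gray_zero⟩, add_zero x⟩
  obtain ⟨u, rfl⟩ := (BlockMatrix.mem_code_iff hp.out.pos).1 hy
  have hdvd (k : Fin A.rows) : p ^ (σ k - 1) ∣ u k := by
    refine hA.pow_dvd ?_ (fun v => ?_) (Nat.lt_succ_iff.1 k.2)
    · rintro ⟨rfl, h⟩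
      exact hnl (hA.isLinearCode h)
    · have h : Gray (A.word u) + Gray (A.word v) ∈ Gray '' (A.code : Set (Mixed p A.width)) := by
        rw [← hx]
        exact ⟨_, ⟨_, A.word_mem_code v, rfl⟩, rfl⟩
      obtain ⟨z, hz, hzu⟩ := h
      obtain ⟨w, rfl⟩ := (BlockMatrix.mem_code_iff hp.out.pos).1 hz
      exact ⟨w, hzu⟩
  choose c hc using hdvd
  have hterm (k : Fin A.rows) : u k • A.row k = c k • p ^ (σ k - 1) • A.row k := by
    rw [hc, mul_comm, mul_smul]
  rw [BlockMatrix.word, Finset.sum_congr rfl fun k _ => hterm k, Gray_sum_of_torsion]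
  · refine Submodule.sum_mem _ fun k _ => ?_
    rw [Gray_nsmul_of_torsion (hA.nsmul_pow_nsmul_row k)]
    exact nsmul_mem (Submodule.subset_span (Set.mem_range_self k)) _
  · intro k _
    rw [smul_comm, hA.nsmul_pow_nsmul_row, smul_zero]

theorem IsStandard.exists_basis (hnl : ¬IsLinearCode (Gray '' (A.code : Set (Mixed p A.width)))) :
    ∃ B : Module.Basis (Fin A.rows) (ZMod p) (kernel (Gray '' (A.code : Set (Mixed p A.width)))),
      ∀ k, (B k : GrayIdx p A.width → ZMod p) =
        Gray ((addOrderOf (A.row k) / p) • A.row k) := by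
  let f (k : Fin A.rows) : kernel (Gray '' (A.code : Set (Mixed p A.width))) :=
    ⟨Gray (p ^ (σ k - 1) • A.row k), hA.Gray_mem_kernel k⟩
  have hf : LinearIndependent (ZMod p) f :=
    LinearIndependent.of_comp (Submodule.subtype _) hA.linearIndependent
  refine ⟨Module.Basis.mk hf ?_, fun k => ?_⟩
  · rintro ⟨x, hx⟩ -
    have h : x ∈ (Submodule.span (ZMod p) (Set.range f)).map (Submodule.subtype _) := by
      rw [Submodule.map_span, ← Set.range_comp]
      exact hA.kernel_le_span hnl hx
    obtain ⟨y, hy, rfl⟩ := h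
    exact hy
  · rw [Module.Basis.mk_apply, hA.addOrderOf_row_div]

end Basis

end Kernel

end GHCode

theorem mainTheorem5 (p : ℕ) [Fact p.Prime] (s : ℕ) (hs : 2 ≤ s) (t : Fin s → ℕ)
    (ht_first : 1 ≤ t ⟨0, by omega⟩) (ht_last : 1 ≤ t ⟨s - 1, by omega⟩)
    (hnonlinear : ¬ GHCode.IsLinearCode (GHCode.grayCode p t)) :
    (GHCode.genMatrix p t).rows = ∑ i, t i ∧
    (∃ B : Module.Basis (Fin (GHCode.genMatrix p t).rows) (ZMod p)
        (GHCode.kernel (GHCode.grayCode p t)),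
      ∀ k, (B k : GHCode.GrayIdx p (GHCode.genMatrix p t).width → ZMod p) =
        GHCode.Gray ((addOrderOf ((GHCode.genMatrix p t).row k) / p) •
          (GHCode.genMatrix p t).row k)) ∧
    Module.finrank (ZMod p) (GHCode.kernel (GHCode.grayCode p t)) = ∑ i, t i := by
  obtain ⟨σ, hA⟩ := GHCode.exists_isStandard_genMatrix (p := p) hs t
  have hrows := GHCode.rows_genMatrix p hs t rfl (Nat.sub_add_cancel (by omega)) ht_first ht_last
  obtain ⟨B, hB⟩ := hA.exists_basis hnonlinear
  refine ⟨hrows, ⟨B, hB⟩, ?_⟩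
  rw [← hrows, ← Fintype.card_fin (GHCode.genMatrix p t).rows]
  exact Module.finrank_eq_card_basis B
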